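/- Let $K$ be an algebraically closed field of characteristic $0$, let $S=K[x_1,\dots,x_n]$, and let $f_1,\dots,f_n\in S$ be a regular sequence of homogeneous polynomials of the same degree $d$. Put $I=(f_1,\dots,f_n)$. Order the monomials by the (degree) reverse lexicographic order: $x^a<x^b$ if $\deg x^a<\deg x^b$, or if $\deg x^a=\deg x^b$ and $a_i>b_i$ for the last index $i$ with $a_i\ne b_i$; write $\mathrm{in}(\cdot)$ for the initial ideal with respect to this order. A matrix $g=(g_{ij})\in GL_n(K)$ acts on $S$ by $x_i\mapsto\sum_j g_{ij}x_j$. The generic initial ideal $\mathrm{Gin}(I)$ is the ideal $J$ for which there is a nonempty Zariski open set $U\subseteq GL_n(K)$ with $\mathrm{in}(gI)=J$ for all $g\in U$. A set $M$ of monomials of degree $d$ is a revlex set if, whenever $u\in M$ and $v>u$ is a monomial of degree $d$, also $v\in M$. Then $J=\mathrm{Gin}(I)$ exists and is unique, and the set $J_d$ of monomials of degree $d$ in $J$ has exactly $n$ elements. Moreover: 1. If $f_i\in K[x_i,\dots,x_n]$ for every $i=1,\dots,n$, then $J_d$ is a revlex set, i.e. it consists of the $n$ largest monomials of degree $d$.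 2. In particular, if $S/I$ is a monomial complete intersection, i.e. if $I$ is generated by monomials, then $J_d$ is a revlex set. -/

import Mathlib

open MvPolynomial

/-- Exponent vectors of monomials in `n` variables, as the carrier of the (degree) reverse
lexicographic order. -/
def DegRevLex (n : ℕ) : Type := Fin n →₀ ℕ

namespace DegRevLex

noncomputable instance (n : ℕ) : AddCommMonoid (DegRevLex n) :=
  inferInstanceAs (AddCommMonoid (Fin n →₀ ℕ))

/-- The identity, as an additive equivalence. -/
noncomputable def equiv (n : ℕ) : (Fin n →₀ ℕ) ≃+ DegRevLex n :=
  AddEquiv.refl (Fin n →₀ ℕ)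

/-- The comparison key: first the total degree; for equal degrees, the colexicographic order
(the last differing exponent decides), reversed. -/
noncomputable def key {n : ℕ} (a : DegRevLex n) : ℕ ×ₗ (Colex (Fin n →₀ ℕ))ᵒᵈ :=
  toLex (((equiv n).symm a).degree, OrderDual.toDual (toColex ((equiv n).symm a)))

theorem key_injective (n : ℕ) : Function.Injective (key (n := n)) := by
  intro a b h
  have h' := congrArg (fun k => (ofLex k).2) h
  exact (equiv n).symm.injective (toColex.injective (OrderDual.toDual.injective h'))

noncomputable instance (n : ℕ) : LinearOrder (DegRevLex n) :=
  LinearOrder.lift' key (key_injective n)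

/-- `x ^ a < x ^ b` iff `a` has smaller degree, or the degrees agree and, at the last index
where the exponents differ, `a` has the larger one. -/
theorem equiv_lt_iff {n : ℕ} (a b : Fin n →₀ ℕ) :
    equiv n a < equiv n b ↔ a.degree < b.degree ∨
      (a.degree = b.degree ∧ ∃ i, (∀ j, i < j → a j = b j) ∧ b i < a i) := by
  change key (equiv n a) < key (equiv n b) ↔ _
  simp only [key, AddEquiv.symm_apply_apply, Prod.Lex.toLex_lt_toLex, OrderDual.toDual_lt_toDual]
  refine or_congr Iff.rfl (and_congr Iff.rfl ?_)
  rw [Finsupp.Colex.lt_iff]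
  refine exists_congr fun i => and_congr (forall_congr' fun j => ?_) Iff.rfl
  exact imp_congr Iff.rfl eq_comm

theorem equiv_le_iff {n : ℕ} (a b : Fin n →₀ ℕ) :
    equiv n a ≤ equiv n b ↔ a.degree < b.degree ∨
      (a.degree = b.degree ∧ toColex b ≤ toColex a) := by
  change key (equiv n a) ≤ key (equiv n b) ↔ _
  simp [key, Prod.Lex.toLex_le_toLex]

instance (n : ℕ) : IsOrderedAddMonoid (DegRevLex n) where
  add_le_add_left a b h c := by
    obtain ⟨a, rfl⟩ := (equiv n).surjective a
    obtain ⟨b, rfl⟩ := (equiv n).surjective b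
    obtain ⟨c, rfl⟩ := (equiv n).surjective c
    rw [← map_add, ← map_add]
    rw [equiv_le_iff] at h ⊢
    simpa [map_add] using h

theorem equiv_monotone (n : ℕ) : Monotone (equiv n) := by
  intro a b h
  obtain ⟨c, rfl⟩ := exists_add_of_le h
  rcases eq_or_ne c 0 with rfl | hc
  · simp
  · refine ((equiv_lt_iff _ _).2 (Or.inl ?_)).le
    have : c.degree ≠ 0 := fun h0 => hc ((Finsupp.degree_eq_zero_iff c).1 h0)
    rw [map_add]
    omega

instance (n : ℕ) : WellFoundedLT (DegRevLex n) := by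
  have h : WellQuasiOrderedLE (DegRevLex n) := by
    refine ⟨fun f => ?_⟩
    obtain ⟨i, j, hij, hle⟩ :=
      (wellQuasiOrdered_le (α := Fin n →₀ ℕ)) (fun k => (equiv n).symm (f k))
    exact ⟨i, j, hij, by simpa using equiv_monotone n hle⟩
  infer_instance

end DegRevLex

/-- The reverse lexicographic monomial order on `K[x_1, …, x_n]` (graded, `x_1 > ⋯ > x_n`). -/
noncomputable def revlex (n : ℕ) : MonomialOrder (Fin n) where
  syn := DegRevLex n
  toSyn := DegRevLex.equiv n
  toSyn_monotone := DegRevLex.equiv_monotone n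

theorem revlex_lt_iff {n : ℕ} (a b : Fin n →₀ ℕ) :
    (revlex n).toSyn a < (revlex n).toSyn b ↔ a.degree < b.degree ∨
      (a.degree = b.degree ∧ ∃ i, (∀ j, i < j → a j = b j) ∧ b i < a i) :=
  DegRevLex.equiv_lt_iff a b

/-- The initial ideal: generated by the leading monomials of the nonzero elements of `I`
(`m.degree f` is the exponent vector of the leading monomial of `f`). -/
noncomputable def initialIdeal {σ K : Type*} [Field K] (m : MonomialOrder σ)
    (I : Ideal (MvPolynomial σ K)) : Ideal (MvPolynomial σ K) :=
  Ideal.span {p | ∃ f ∈ I, f ≠ 0 ∧ p = monomial (m.degree f) 1}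

/-- The linear change of coordinates `x_i ↦ ∑ j, g i j • x_j`. -/
noncomputable def coordChange {K : Type*} [Field K] {n : ℕ} (g : GL (Fin n) K) :
    MvPolynomial (Fin n) K →ₐ[K] MvPolynomial (Fin n) K :=
  aeval fun i => ∑ j, C ((g : Matrix (Fin n) (Fin n) K) i j) * X j

/-- Zariski open subsets of `GL_n(K)`: the traces of the Zariski open subsets of the affine space
of `n × n` matrices, i.e. the sets on which not all polynomials of some family vanish. -/
def IsZariskiOpenGL {K : Type*} [Field K] {n : ℕ} (U : Set (GL (Fin n) K)) : Prop :=
  ∃ P : Set (MvPolynomial (Fin n × Fin n) K),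
    U = {g : GL (Fin n) K |
      ∃ p ∈ P, eval (fun ij => (g : Matrix (Fin n) (Fin n) K) ij.1 ij.2) p ≠ 0}

/-- `J` is the generic initial ideal of `I`: the initial ideal of `g I` is `J` for all `g` in some
nonempty Zariski open subset of `GL_n(K)`. -/
def IsGenericInitialIdeal {K : Type*} [Field K] {n : ℕ} (m : MonomialOrder (Fin n))
    (I J : Ideal (MvPolynomial (Fin n) K)) : Prop :=
  ∃ U : Set (GL (Fin n) K), IsZariskiOpenGL U ∧ U.Nonempty ∧
    ∀ g ∈ U, initialIdeal m (I.map (coordChange g)) = J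

/-- The set of monomials of degree `d` in `J`, as exponent vectors. -/
def monomialsOfDegree {K : Type*} [Field K] {n : ℕ} (J : Ideal (MvPolynomial (Fin n) K)) (d : ℕ) :
    Set (Fin n →₀ ℕ) :=
  {a | a.degree = d ∧ monomial a (1 : K) ∈ J}

/-- A revlex set of monomials: it contains, with each monomial, every monomial of the same degree
that is greater in the reverse lexicographic order. -/
def IsRevlexSet {n : ℕ} (M : Set (Fin n →₀ ℕ)) : Prop :=
  ∀ a ∈ M, ∀ b : Fin n →₀ ℕ, b.degree = a.degree →
    (revlex n).toSyn a < (revlex n).toSyn b → b ∈ M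

/-- An ideal generated by monomials. -/
def IsMonomialIdeal {σ K : Type*} [Field K] (I : Ideal (MvPolynomial σ K)) : Prop :=
  ∃ A : Set (σ →₀ ℕ), I = Ideal.span ((fun a => monomial a (1 : K)) '' A)

/-! The coefficients of `g p`, hence the minors of a family of polynomials at prescribed monomials,
are polynomials in the entries of `g`. A nonvanishing minor yields, by inverting it, an element of
`g I` with a single nonzero coefficient among those monomials
(`mem_leadingExponents_of_minor_ne_zero`).

Existence of the generic initial ideal: up to a degree bound only finitely many sets of leading
exponents occur, and the colexicographically largest is attained wherever a suitable minor is
nonzero. Noetherianity reduces the infinitely many bounds to finitely many. In degree `d` only the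
`K`-span of the `f i` matters, and regularity gives it dimension `n`.

For the revlex property it suffices that the minor of the `f i` at every set of `n` monomials of
degree `d` is generically nonzero: if `c > a` with `a` in `J_d` and `c` outside, the minor at `J_d`
with `a` replaced by `c` forces `c` into `J_d`. For `x_i ^ d` the minor is a product of multinomial
coefficients, nonzero in characteristic zero, times a determinant whose Leibniz terms are distinct
monomials. A triangular family degenerates to multiples of the `x_i ^ d` by scaling row `k` of `g`
by `s ^ k`; a height argument shows that these multiples are nonzero. A monomial complete
intersection is `(x_1 ^ d, …, x_n ^ d)`, which is triangular. -/

/-- The exponent vectors of the leading monomials of the nonzero elements of `I`. -/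
def leadingExponents {σ K : Type*} [Field K] (m : MonomialOrder σ)
    (I : Ideal (MvPolynomial σ K)) : Set (σ →₀ ℕ) :=
  {a | ∃ f ∈ I, f ≠ 0 ∧ m.degree f = a}

theorem initialIdeal_eq_span {σ K : Type*} [Field K] (m : MonomialOrder σ)
    (I : Ideal (MvPolynomial σ K)) :
    initialIdeal m I = Ideal.span ((fun a => monomial a (1 : K)) '' leadingExponents m I) := by
  unfold initialIdeal leadingExponents
  congr 1
  ext p
  constructor
  · rintro ⟨f, hf, h0, rfl⟩
    exact ⟨_, ⟨f, hf, h0, rfl⟩, rfl⟩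
  · rintro ⟨_, ⟨f, hf, h0, rfl⟩, rfl⟩
    exact ⟨f, hf, h0, rfl⟩

theorem leadingExponents_upward {σ K : Type*} [Field K] (m : MonomialOrder σ)
    (I : Ideal (MvPolynomial σ K)) {a b : σ →₀ ℕ} (ha : a ∈ leadingExponents m I) (hab : a ≤ b) :
    b ∈ leadingExponents m I := by
  obtain ⟨f, hf, h0, rfl⟩ := ha
  obtain ⟨c, rfl⟩ := exists_add_of_le hab
  have hc : (monomial c (1 : K)) ≠ 0 := by simp
  refine ⟨f * monomial c 1, I.mul_mem_right _ hf, mul_ne_zero h0 hc, ?_⟩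
  classical
  rw [m.degree_mul h0 hc, m.degree_monomial, if_neg one_ne_zero]

theorem monomial_mem_initialIdeal_iff {σ K : Type*} [Field K] (m : MonomialOrder σ)
    (I : Ideal (MvPolynomial σ K)) (a : σ →₀ ℕ) :
    monomial a (1 : K) ∈ initialIdeal m I ↔ a ∈ leadingExponents m I := by
  rw [initialIdeal_eq_span, mem_ideal_span_monomial_image]
  constructor
  · intro h
    obtain ⟨b, hb, hba⟩ := h a (by classical simp [support_monomial])
    exact leadingExponents_upward m I hb hba
  · intro h b hb
    classical
    rw [support_monomial, if_neg one_ne_zero, Finset.mem_singleton] at hb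
    exact ⟨a, h, hb ▸ le_rfl⟩

theorem revlex_degree_le {n : ℕ} {a b : Fin n →₀ ℕ}
    (h : (revlex n).toSyn a ≤ (revlex n).toSyn b) : a.degree ≤ b.degree := by
  rcases h.lt_or_eq with h | h
  · rcases (revlex_lt_iff a b).1 h with h | h
    · exact h.le
    · exact h.1.le
  · rw [(revlex n).toSyn.injective h]

theorem totalDegree_eq_degree_revlex {n : ℕ} {K : Type*} [Field K] (f : MvPolynomial (Fin n) K) :
    f.totalDegree = ((revlex n).degree f).degree := by
  rcases eq_or_ne f 0 with rfl | h0
  · simp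
  apply le_antisymm
  · refine Finset.sup_le fun a ha => ?_
    exact revlex_degree_le ((revlex n).le_degree ha)
  · exact le_totalDegree ((revlex n).degree_mem_support h0)

/-! ### Linear substitutions and generic minors -/

/-- The linear substitution `x_i ↦ ∑ j, N i j • x_j` with coefficients in a `K`-algebra. -/
noncomputable def linSubst (K : Type*) {R : Type*} [Field K] [CommRing R] [Algebra K R] {n : ℕ}
    (N : Matrix (Fin n) (Fin n) R) : MvPolynomial (Fin n) K →ₐ[K] MvPolynomial (Fin n) R :=
  aeval fun i => ∑ j, C (N i j) * X j

section linSubst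

variable {K R R' : Type*} [Field K] [CommRing R] [Algebra K R] [CommRing R'] [Algebra K R'] {n : ℕ}

theorem coordChange_eq_linSubst (g : GL (Fin n) K) :
    coordChange g = linSubst K (g : Matrix (Fin n) (Fin n) K) := rfl

theorem map_linSubst (φ : R →ₐ[K] R') (N : Matrix (Fin n) (Fin n) R)
    (p : MvPolynomial (Fin n) K) :
    map (φ : R →+* R') (linSubst K N p) = linSubst K (N.map φ) p := by
  have : (mapAlgHom φ).comp (linSubst K N) = linSubst K (N.map φ) := by
    apply algHom_ext
    intro i
    simp [linSubst]
  exact DFunLike.congr_fun this p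

theorem isHomogeneous_linSubst (N : Matrix (Fin n) (Fin n) R) {p : MvPolynomial (Fin n) K} {d : ℕ}
    (hp : p.IsHomogeneous d) : (linSubst K N p).IsHomogeneous d := by
  have := hp.aeval (fun i => ∑ j, C (N i j) * X j) (n := 1) fun i =>
    IsHomogeneous.sum _ _ _ fun j _ => by
      simpa using (isHomogeneous_C (Fin n) (N i j)).mul (isHomogeneous_X R j)
  simpa [linSubst] using this

theorem totalDegree_linSubst_le (N : Matrix (Fin n) (Fin n) R) (p : MvPolynomial (Fin n) K) :
    (linSubst K N p).totalDegree ≤ p.totalDegree := by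
  conv_lhs => rw [← sum_homogeneousComponent p, map_sum]
  refine (totalDegree_finsetSum _ _).trans (Finset.sup_le fun i hi => ?_)
  refine (isHomogeneous_linSubst N (homogeneousComponent_isHomogeneous i p)).totalDegree_le.trans ?_
  have := Finset.mem_range.1 hi
  omega

/-- Substitution is contravariant: rows of `h` are expanded by `g`, so the factors appear reversed.
-/
theorem coordChange_coordChange (g h : GL (Fin n) K) (p : MvPolynomial (Fin n) K) :
    coordChange g (coordChange h p) = coordChange (h * g) p := by
  have : (coordChange g).comp (coordChange h) = coordChange (h * g) := by
    apply algHom_ext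
    intro i
    simp only [coordChange, AlgHom.comp_apply, aeval_X, map_sum, map_mul, algHom_C, algebraMap_eq,
      Units.val_mul, Matrix.mul_apply, Finset.mul_sum, Finset.sum_mul]
    rw [Finset.sum_comm]
    simp only [mul_assoc]
  exact DFunLike.congr_fun this p

theorem coordChange_one (p : MvPolynomial (Fin n) K) : coordChange (1 : GL (Fin n) K) p = p := by
  have : coordChange (1 : GL (Fin n) K) = AlgHom.id K _ := by
    apply algHom_ext
    intro i
    simp [coordChange, Matrix.one_apply]
  rw [this]; rfl

theorem coordChange_injective (g : GL (Fin n) K) : Function.Injective (coordChange g) :=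
  Function.LeftInverse.injective (g := coordChange g⁻¹) fun p => by
    rw [coordChange_coordChange, mul_inv_cancel, coordChange_one]

theorem coordChange_surjective (g : GL (Fin n) K) : Function.Surjective (coordChange g) :=
  Function.RightInverse.surjective (g := coordChange g⁻¹) fun p => by
    rw [coordChange_coordChange, inv_mul_cancel, coordChange_one]

theorem totalDegree_coordChange (g : GL (Fin n) K) (p : MvPolynomial (Fin n) K) :
    (coordChange g p).totalDegree = p.totalDegree := by
  refine le_antisymm (totalDegree_linSubst_le _ p) ?_
  have := totalDegree_linSubst_le (K := K) ((g⁻¹ : GL (Fin n) K) : Matrix (Fin n) (Fin n) K)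
    (coordChange g p)
  rwa [← coordChange_eq_linSubst, coordChange_coordChange, mul_inv_cancel, coordChange_one] at this

/-- The coefficient of `x ^ a` in `g p`, as a polynomial in the entries of the matrix `g`. -/
noncomputable def genericCoeff (p : MvPolynomial (Fin n) K) (a : Fin n →₀ ℕ) :
    MvPolynomial (Fin n × Fin n) K :=
  coeff a (linSubst K (Matrix.of fun i j => (X (i, j) : MvPolynomial (Fin n × Fin n) K)) p)

theorem eval_genericCoeff (N : Matrix (Fin n) (Fin n) K) (p : MvPolynomial (Fin n) K)
    (a : Fin n →₀ ℕ) :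
    eval (fun ij => N ij.1 ij.2) (genericCoeff p a) = coeff a (linSubst K N p) := by
  have h := map_linSubst (K := K) (aeval (R := K) fun ij : Fin n × Fin n => N ij.1 ij.2)
    (Matrix.of fun i j => (X (i, j) : MvPolynomial (Fin n × Fin n) K)) p
  have h2 : (Matrix.of fun i j => (X (i, j) : MvPolynomial (Fin n × Fin n) K)).map
      (aeval (R := K) fun ij : Fin n × Fin n => N ij.1 ij.2) = N := by
    ext i j; simp
  rw [h2] at h
  rw [← h, coeff_map, genericCoeff]
  rfl

/-- The minor of the coefficients of `g p_i` at `x ^ b_j`, as a polynomial in the entries of `g`. -/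
noncomputable def genericMinor {ι : Type*} [Fintype ι] [DecidableEq ι]
    (p : ι → MvPolynomial (Fin n) K) (b : ι → Fin n →₀ ℕ) : MvPolynomial (Fin n × Fin n) K :=
  (Matrix.of fun i j => genericCoeff (p i) (b j)).det

theorem eval_genericMinor {ι : Type*} [Fintype ι] [DecidableEq ι]
    (p : ι → MvPolynomial (Fin n) K) (b : ι → Fin n →₀ ℕ) (N : Matrix (Fin n) (Fin n) K) :
    eval (fun ij => N ij.1 ij.2) (genericMinor p b) =
      (Matrix.of fun i j => coeff (b j) (linSubst K N (p i))).det := by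
  rw [genericMinor, RingHom.map_det]
  congr 1
  ext i j
  simp [eval_genericCoeff]

end linSubst

/-! ### Zariski open subsets of the general linear group -/

section open_sets

variable {K : Type*} [Field K] {n : ℕ}

/-- Multiplying by the generic determinant makes any point of nonvanishing an invertible matrix. -/
theorem exists_eval_ne_zero_GL [Infinite K] {p : MvPolynomial (Fin n × Fin n) K} (hp : p ≠ 0) :
    ∃ g : GL (Fin n) K, eval (fun ij => (g : Matrix (Fin n) (Fin n) K) ij.1 ij.2) p ≠ 0 := by
  set D : MvPolynomial (Fin n × Fin n) K := (Matrix.of fun i j => X (i, j)).det with hD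
  have hev : ∀ N : Matrix (Fin n) (Fin n) K, eval (fun ij => N ij.1 ij.2) D = N.det := by
    intro N
    rw [hD, RingHom.map_det]
    congr 1
    ext i j
    simp
  have hD0 : D ≠ 0 := by
    intro h
    have := hev 1
    simp [h] at this
  obtain ⟨x, hx⟩ : ∃ x, eval x (p * D) ≠ 0 := by
    by_contra! h
    exact mul_ne_zero hp hD0 (funext fun x => by simpa using h x)
  rw [map_mul] at hx
  have hdet := hev (Matrix.of fun i j => x (i, j))
  refine ⟨Matrix.GeneralLinearGroup.mkOfDetNeZero (Matrix.of fun i j => x (i, j)) ?_, ?_⟩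
  · rw [← hdet]
    exact right_ne_zero_of_mul hx
  · exact left_ne_zero_of_mul hx

theorem IsZariskiOpenGL.exists_polynomial {U : Set (GL (Fin n) K)} (hU : IsZariskiOpenGL U)
    (hne : U.Nonempty) : ∃ p : MvPolynomial (Fin n × Fin n) K, p ≠ 0 ∧ ∀ g : GL (Fin n) K,
      eval (fun ij => (g : Matrix (Fin n) (Fin n) K) ij.1 ij.2) p ≠ 0 → g ∈ U := by
  obtain ⟨P, rfl⟩ := hU
  obtain ⟨g, p, hp, hg⟩ := hne
  exact ⟨p, fun h => hg (by simp [h]), fun g hg => ⟨p, hp, hg⟩⟩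

theorem isZariskiOpenGL_eval_ne_zero (p : MvPolynomial (Fin n × Fin n) K) :
    IsZariskiOpenGL {g : GL (Fin n) K |
      eval (fun ij => (g : Matrix (Fin n) (Fin n) K) ij.1 ij.2) p ≠ 0} :=
  ⟨{p}, by simp⟩

end open_sets

/-! ### Leading monomials and minors -/

section leading

variable {K : Type*} [Field K] {n : ℕ}

theorem mem_leadingExponents_map_iff (I : Ideal (MvPolynomial (Fin n) K)) (g : GL (Fin n) K)
    (m : MonomialOrder (Fin n)) (a : Fin n →₀ ℕ) :
    a ∈ leadingExponents m (I.map (coordChange g)) ↔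
      ∃ p ∈ I, p ≠ 0 ∧ m.degree (coordChange g p) = a := by
  constructor
  · rintro ⟨f, hf, h0, rfl⟩
    obtain ⟨p, hp, rfl⟩ := (Ideal.mem_map_iff_of_surjective _ (coordChange_surjective g)).1 hf
    exact ⟨p, hp, fun h => h0 (by simp [h]), rfl⟩
  · rintro ⟨p, hp, h0, rfl⟩
    exact ⟨_, Ideal.mem_map_of_mem _ hp,
      (map_ne_zero_iff _ (coordChange_injective g)).2 h0, rfl⟩

/-- If a minor of `I` at the monomials `x ^ b_j` does not vanish, then these monomials cannot beat
the leading monomials of `I`. -/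
theorem mem_leadingExponents_of_minor_ne_zero {ι : Type*} [Fintype ι] [DecidableEq ι]
    {I : Ideal (MvPolynomial (Fin n) K)} {e : ℕ} (q : ι → MvPolynomial (Fin n) K)
    (hq : ∀ i, q i ∈ I) (hqe : ∀ i, (q i).totalDegree ≤ e) (b : ι → Fin n →₀ ℕ)
    (hdet : (Matrix.of fun i j => coeff (b j) (q i)).det ≠ 0) (i : ι)
    (h : ∀ x ∈ leadingExponents (revlex n) I, x.degree ≤ e →
      (revlex n).toSyn (b i) < (revlex n).toSyn x → ∃ j, b j = x) :
    b i ∈ leadingExponents (revlex n) I := by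
  set A : Matrix ι ι K := Matrix.of fun i j => coeff (b j) (q i) with hA
  -- Row `i` of the inverse matrix makes the coefficient of `w` at `b j` equal to the Kronecker
  -- delta.
  set w : MvPolynomial (Fin n) K := ∑ s, C (A⁻¹ i s) * q s with hw
  have hcoeff : ∀ j, coeff (b j) w = (1 : Matrix ι ι K) i j := by
    intro j
    rw [← Matrix.nonsing_inv_mul A (isUnit_iff_ne_zero.2 hdet), Matrix.mul_apply, hw, coeff_sum]
    simp [hA]
  have hwI : w ∈ I := I.sum_mem fun s _ => I.mul_mem_left _ (hq s)
  have hwe : w.totalDegree ≤ e := by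
    refine (totalDegree_finsetSum _ _).trans (Finset.sup_le fun s _ => ?_)
    refine (totalDegree_mul _ _).trans ?_
    simpa using hqe s
  have hci : coeff (b i) w ≠ 0 := by simp [hcoeff]
  have hw0 : w ≠ 0 := fun h0 => hci (by simp [h0])
  have hle : (revlex n).toSyn (b i) ≤ (revlex n).toSyn ((revlex n).degree w) :=
    (revlex n).le_degree (mem_support_iff.2 hci)
  have hmem : (revlex n).degree w ∈ leadingExponents (revlex n) I := ⟨w, hwI, hw0, rfl⟩
  rcases hle.lt_or_eq with hlt | heq
  -- A leading exponent above `b i` would be some `b j` with `j ≠ i`, where `w` has coefficient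
  -- zero.
  · obtain ⟨j, hj⟩ := h _ hmem (by rwa [← totalDegree_eq_degree_revlex]) hlt
    have hne : i ≠ j := by
      rintro rfl
      rw [hj] at hlt
      exact lt_irrefl _ hlt
    have := hcoeff j
    rw [hj, Matrix.one_apply_ne hne] at this
    exact absurd this ((revlex n).coeff_degree_ne_zero_iff.2 hw0)
  · rw [(revlex n).toSyn.injective heq]
    exact hmem

/-- The matrix is triangular for the monomial order: in a linear relation between rows, the largest
leading monomial involved occurs in only one of them. -/
theorem det_coeff_degree_ne_zero {σ ι : Type*} [Fintype ι] [DecidableEq ι] (m : MonomialOrder σ)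
    (q : ι → MvPolynomial σ K) (hq : ∀ i, q i ≠ 0) (b : ι → σ →₀ ℕ)
    (hb : ∀ i, m.degree (q i) = b i) (hinj : Function.Injective b) :
    (Matrix.of fun i j => coeff (b j) (q i)).det ≠ 0 := by
  intro h0
  obtain ⟨v, hv, hvA⟩ := Matrix.exists_vecMul_eq_zero_iff.2 h0
  classical
  obtain ⟨k, hk⟩ := Function.ne_iff.1 hv
  obtain ⟨a, ha, hmax⟩ := Finset.exists_max_image (Finset.univ.filter fun i => v i ≠ 0)
    (fun i => m.toSyn (b i)) ⟨k, by simpa using hk⟩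
  have ha' : v a ≠ 0 := by simpa using ha
  have hs := congrFun hvA a
  simp only [Matrix.vecMul, dotProduct, Matrix.of_apply, Pi.zero_apply] at hs
  rw [Finset.sum_eq_single a] at hs
  · have := m.coeff_degree_ne_zero_iff.2 (hq a)
    rw [hb] at this
    exact mul_ne_zero ha' this hs
  · intro c _ hca
    by_cases hc : v c = 0
    · simp [hc]
    · have hle := hmax c (by simpa using hc)
      rw [m.coeff_eq_zero_of_lt, mul_zero]
      rw [hb]
      exact lt_of_le_of_ne hle fun h => hca (hinj (m.toSyn.injective h))
  · simp

end leading

/-! ### Existence and uniqueness of the generic initial ideal -/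

section generic_initial_ideal

variable {K : Type*} [Field K] {n : ℕ}

/-- The exponents of degree at most `e` of the leading monomials of `g I`. -/
def leadingExponentsUpTo (I : Ideal (MvPolynomial (Fin n) K)) (e : ℕ) (g : GL (Fin n) K) :
    Set (Fin n →₀ ℕ) :=
  {a | a.degree ≤ e ∧ a ∈ leadingExponents (revlex n) (I.map (coordChange g))}

theorem finite_degree_le (e : ℕ) : {a : Fin n →₀ ℕ | a.degree ≤ e}.Finite := by
  have h : {a : Fin n →₀ ℕ | a.degree ≤ e} ⊆ Set.Iic (Finsupp.equivFunOnFinite.symm fun _ => e) := by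
    intro a ha i
    exact (Finsupp.le_degree i a).trans ha
  exact (Set.finite_Iic _).subset h

theorem finite_leadingExponentsUpTo (I : Ideal (MvPolynomial (Fin n) K)) (e : ℕ)
    (g : GL (Fin n) K) : (leadingExponentsUpTo I e g).Finite :=
  (finite_degree_le e).subset fun _ h => h.1

open Classical in
/-- In each degree the leading exponents of `g I` have a generic value, which is maximal. -/
theorem exists_generic_leadingExponentsUpTo (I : Ideal (MvPolynomial (Fin n) K)) (e : ℕ) :
    ∃ (T : Set (Fin n →₀ ℕ)) (p : MvPolynomial (Fin n × Fin n) K), p ≠ 0 ∧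
      (∀ g : GL (Fin n) K, eval (fun ij => (g : Matrix (Fin n) (Fin n) K) ij.1 ij.2) p ≠ 0 →
        leadingExponentsUpTo I e g = T) ∧
      ∀ g : GL (Fin n) K, T ⊆ leadingExponentsUpTo I e g → leadingExponentsUpTo I e g = T := by
  -- Transported to `syn`, the sets of leading exponents can be compared in colexicographic order; a
  -- maximal one is the generic value.
  let F : GL (Fin n) K → Finset (revlex n).syn := fun g =>
    (finite_leadingExponentsUpTo I e g).toFinset.map (revlex n).toSyn.toEquiv.toEmbedding
  have hF : ∀ g a, (revlex n).toSyn a ∈ F g ↔ a ∈ leadingExponentsUpTo I e g := by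
    intro g a
    simp [F]
  have hFeq : ∀ g h, F g = F h → leadingExponentsUpTo I e g = leadingExponentsUpTo I e h := by
    intro g h hgh
    ext a
    rw [← hF, ← hF, hgh]
  have hfin : (Set.range fun g => toColex (F g)).Finite := by
    refine Set.Finite.subset (((finite_degree_le (n := n) e).toFinset.map
      (revlex n).toSyn.toEquiv.toEmbedding).powerset.finite_toSet.image toColex) ?_
    rintro _ ⟨g, rfl⟩
    refine ⟨F g, ?_, rfl⟩
    simp only [Finset.coe_powerset, Set.mem_preimage, Set.mem_powerset_iff, Finset.coe_subset]
    intro a ha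
    obtain ⟨a, rfl⟩ := (revlex n).toSyn.surjective a
    simpa using ((hF g a).1 ha).1
  obtain ⟨_, ⟨g₀, rfl⟩, hmax⟩ := hfin.exists_maximal (Set.range_nonempty _)
  have hmax' : ∀ g, ¬ toColex (F g₀) < toColex (F g) := fun g hg =>
    absurd (hmax ⟨g, rfl⟩ hg.le) hg.not_ge
  have hlead : ∀ a : leadingExponentsUpTo I e g₀, ∃ p ∈ I, p ≠ 0 ∧
      (revlex n).degree (coordChange g₀ p) = a :=
    fun a => (mem_leadingExponents_map_iff I g₀ _ _).1 a.2.2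
  choose p hpI hp0 hpdeg using hlead
  have : Fintype (leadingExponentsUpTo I e g₀) := (finite_leadingExponentsUpTo I e g₀).fintype
  refine ⟨leadingExponentsUpTo I e g₀, genericMinor p (fun a => a.1), ?_, ?_, ?_⟩
  · intro h0
    have h1 := eval_genericMinor p (fun a => a.1) (g₀ : Matrix (Fin n) (Fin n) K)
    rw [h0, map_zero] at h1
    exact det_coeff_degree_ne_zero (revlex n) (fun a => coordChange g₀ (p a))
      (fun a => (map_ne_zero_iff _ (coordChange_injective g₀)).2 (hp0 a)) _ hpdeg
      Subtype.val_injective h1.symm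
  · intro g hg
    rw [eval_genericMinor] at hg
    apply hFeq
    by_contra hne
    have hlt : toColex (F g) < toColex (F g₀) :=
      lt_of_le_of_ne (not_lt.1 (hmax' g)) fun h => hne (toColex.injective h)
    -- The largest difference is some `a` in `F g₀` but not in `F g`; every leading exponent of `g
    -- I` above `a` within the bound lies in `F g₀`, so the nonzero minor forces `a` into `F g`.
    rw [Finset.Colex.toColex_lt_toColex_iff_exists_forall_lt] at hlt
    obtain ⟨a, ha, hag, hab⟩ := hlt
    obtain ⟨a, rfl⟩ := (revlex n).toSyn.surjective a
    rw [hF] at ha hag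
    refine hag ⟨ha.1, mem_leadingExponents_of_minor_ne_zero (e := e) (fun s => coordChange g (p s))
      (fun s => Ideal.mem_map_of_mem _ (hpI s)) (fun s => ?_) (fun s => s.1) hg ⟨a, ha⟩ ?_⟩
    · rw [totalDegree_coordChange, ← totalDegree_coordChange g₀, totalDegree_eq_degree_revlex, hpdeg]
      exact s.2.1
    · intro x hx hxe hax
      by_contra hxT
      have := hab ((revlex n).toSyn x) ((hF _ _).2 ⟨hxe, hx⟩)
        fun h => hxT ⟨⟨x, (hF _ _).1 h⟩, rfl⟩
      exact lt_asymm this hax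
  · intro g hg
    apply hFeq
    by_contra hne
    refine hmax' g (lt_of_le_of_ne (Finset.Colex.toColex_le_toColex_of_subset ?_)
      fun h => hne (toColex.injective h).symm)
    intro a ha
    obtain ⟨a, rfl⟩ := (revlex n).toSyn.surjective a
    rw [hF] at ha ⊢
    exact hg ha

theorem leadingExponents_eq_iUnion (I : Ideal (MvPolynomial (Fin n) K)) (g : GL (Fin n) K) :
    leadingExponents (revlex n) (I.map (coordChange g)) = ⋃ e, leadingExponentsUpTo I e g := by
  ext a
  simp only [Set.mem_iUnion]
  exact ⟨fun h => ⟨a.degree, le_rfl, h⟩, fun ⟨_, h⟩ => h.2⟩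

/-- The ideals generated by the generic exponents up to `M` stabilize at some `N`, so the conditions
for `e ≤ N` already put every `T e` into the initial ideal; maximality of `T e` then gives equality
for all `e`. -/
theorem exists_isGenericInitialIdeal [Infinite K] (I : Ideal (MvPolynomial (Fin n) K)) :
    ∃ J, IsGenericInitialIdeal (revlex n) I J := by
  choose T p hp0 hpT hmax using exists_generic_leadingExponentsUpTo I
  let φ : (Fin n →₀ ℕ) → MvPolynomial (Fin n) K := fun a => monomial a 1
  let J : ℕ →o Ideal (MvPolynomial (Fin n) K) :=
    ⟨fun N => Ideal.span (φ '' ⋃ e ≤ N, T e), fun M N h => Ideal.span_mono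
      (Set.image_mono (Set.biUnion_subset_biUnion_left fun e he => le_trans he h))⟩
  obtain ⟨N, hN⟩ := monotone_stabilizes_iff_noetherian.2
    (inferInstance : IsNoetherian (MvPolynomial (Fin n) K) (MvPolynomial (Fin n) K)) J
  let P := ∏ e ∈ Finset.range (N + 1), p e
  have hP : P ≠ 0 := Finset.prod_ne_zero_iff.2 fun e _ => hp0 e
  refine ⟨Ideal.span (φ '' ⋃ e, T e), _, isZariskiOpenGL_eval_ne_zero P,
    exists_eval_ne_zero_GL hP, fun g hg => ?_⟩
  have hg' : ∀ e ≤ N, leadingExponentsUpTo I e g = T e := by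
    intro e he
    apply hpT
    have := hg
    simp only [Set.mem_ofPred_eq, P, map_prod, Finset.prod_ne_zero_iff, Finset.mem_range] at this
    exact this e (by omega)
  have hJ : ∀ M, J M ≤ initialIdeal (revlex n) (I.map (coordChange g)) := by
    intro M
    have hMN : J M ≤ J N := by
      rcases le_total N M with h | h
      · exact (hN M h).ge
      · exact J.monotone h
    refine hMN.trans (Ideal.span_le.2 ?_)
    rintro _ ⟨a, ha, rfl⟩
    simp only [Set.mem_iUnion] at ha
    obtain ⟨e, he, ha⟩ := ha
    rw [← hg' e he] at ha
    exact (monomial_mem_initialIdeal_iff _ _ _).2 ha.2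
  have hall : ∀ e, leadingExponentsUpTo I e g = T e := by
    intro e
    apply hmax
    obtain ⟨h, hh⟩ := exists_eval_ne_zero_GL (hp0 e)
    intro a ha
    have ha' := ha
    rw [← hpT e h hh] at ha'
    refine ⟨ha'.1, (monomial_mem_initialIdeal_iff _ _ _).1 (hJ e (Ideal.subset_span ⟨a, ?_, rfl⟩))⟩
    simp only [Set.mem_iUnion]
    exact ⟨e, le_rfl, ha⟩
  rw [initialIdeal_eq_span, leadingExponents_eq_iUnion]
  simp only [hall, φ]

theorem IsGenericInitialIdeal.exists_polynomial {m : MonomialOrder (Fin n)}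
    {I J : Ideal (MvPolynomial (Fin n) K)} (hJ : IsGenericInitialIdeal m I J) :
    ∃ p : MvPolynomial (Fin n × Fin n) K, p ≠ 0 ∧ ∀ g : GL (Fin n) K,
      eval (fun ij => (g : Matrix (Fin n) (Fin n) K) ij.1 ij.2) p ≠ 0 →
        initialIdeal m (I.map (coordChange g)) = J := by
  obtain ⟨U, hU, hne, h⟩ := hJ
  obtain ⟨p, hp, hpU⟩ := hU.exists_polynomial hne
  exact ⟨p, hp, fun g hg => h g (hpU g hg)⟩

theorem IsGenericInitialIdeal.unique [Infinite K] {m : MonomialOrder (Fin n)}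
    {I J J' : Ideal (MvPolynomial (Fin n) K)} (hJ : IsGenericInitialIdeal m I J)
    (hJ' : IsGenericInitialIdeal m I J') : J = J' := by
  obtain ⟨p, hp, h⟩ := hJ.exists_polynomial
  obtain ⟨p', hp', h'⟩ := hJ'.exists_polynomial
  obtain ⟨g, hg⟩ := exists_eval_ne_zero_GL (mul_ne_zero hp hp')
  rw [map_mul] at hg
  rw [← h g (left_ne_zero_of_mul hg), h' g (right_ne_zero_of_mul hg)]

end generic_initial_ideal

/-! ### Regular sequences, heights and linear independence -/

/-- A prime ideal containing a regular sequence of length `n` has height at least `n`. -/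
theorem length_le_height_of_isWeaklyRegular {R : Type*} [CommRing R] [IsNoetherianRing R]
    {rs : List R} (reg : RingTheory.Sequence.IsWeaklyRegular R rs) (p : Ideal R) [p.IsPrime]
    (hp : ∀ r ∈ rs, r ∈ p) : (rs.length : ℕ∞) ≤ p.height := by
  have : IsNoetherianRing (Localization.AtPrime p) := IsLocalization.isNoetherianRing p.primeCompl _ ‹_›
  have hreg := reg.isRegular_of_isLocalization_of_mem (Localization.AtPrime p) p hp
  -- In the local ring at `p` the sequence lowers the dimension by its length, and the quotient is
  -- nonzero, so its dimension is nonnegative.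
  have h := ringKrullDim_add_length_eq_ringKrullDim_of_isRegular _ hreg
  rw [IsLocalization.AtPrime.ringKrullDim_eq_height p (Localization.AtPrime p), List.length_map] at h
  have hne : Nontrivial (Localization.AtPrime p ⧸
      Ideal.ofList (rs.map (algebraMap R (Localization.AtPrime p)))) := by
    have := hreg.top_ne_smul
    rw [Ideal.smul_eq_mul, Ideal.mul_top] at this
    exact Ideal.Quotient.nontrivial_iff.2 this.symm
  have h0 := ringKrullDim_nonneg_of_nontrivial (R := Localization.AtPrime p ⧸
      Ideal.ofList (rs.map (algebraMap R (Localization.AtPrime p))))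
  have h1 : ((rs.length : ℕ∞) : WithBot ℕ∞) ≤ (p.height : WithBot ℕ∞) := by
    rw [← h]
    exact le_add_of_nonneg_left h0
  exact WithBot.coe_le_coe.1 h1

/-- A regular sequence of length `n` is not contained in a proper ideal with fewer generators. -/
theorem not_subset_span_of_isWeaklyRegular {R : Type*} [CommRing R] [IsNoetherianRing R]
    {rs : List R} (reg : RingTheory.Sequence.IsWeaklyRegular R rs) {s : Set R} (hs : s.Finite)
    (hcard : s.ncard < rs.length) (htop : Ideal.span s ≠ ⊤) : ¬ ∀ r ∈ rs, r ∈ Ideal.span s := by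
  intro h
  obtain ⟨p, hp⟩ := Ideal.nonempty_minimalPrimes htop
  have := hp.1.1
  have h1 := length_le_height_of_isWeaklyRegular reg p fun r hr => hp.1.2 (h r hr)
  -- Krull's height theorem bounds the height of a minimal prime by the number of generators.
  have h2 := h1.trans (Ideal.height_le_card_of_mem_minimalPrimes_span hs hp)
  exact absurd hcard (not_lt.2 (by exact_mod_cast h2))

/-- In a relation, the last `f i` with nonzero coefficient lies in the ideal of its predecessors, so
it kills `1` in the quotient; regularity makes that quotient zero, against properness. -/
theorem linearIndependent_of_isRegular {K R : Type*} [Field K] [CommRing R] [Algebra K R] {n : ℕ}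
    (f : Fin n → R) (hreg : RingTheory.Sequence.IsRegular R (List.ofFn f)) :
    LinearIndependent K f := by
  rw [Fintype.linearIndependent_iff]
  intro c hc
  by_contra! hne
  classical
  obtain ⟨k, hk⟩ := hne
  obtain ⟨i, hi, hmax⟩ := Finset.exists_max_image (Finset.univ.filter fun i => c i ≠ 0) id
    ⟨k, by simpa using hk⟩
  have hci : c i ≠ 0 := by simpa using hi
  set I := Ideal.ofList ((List.ofFn f).take i) with hI
  have hprev : ∀ j < i, f j ∈ I := fun j hj => Ideal.subset_span <| by
    rw [Set.mem_ofPred_eq, List.mem_take_iff_getElem]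
    exact ⟨j, by simpa using hj, by simp⟩
  have hfi : f i ∈ I := by
    have h1 : c i • f i = -∑ j ∈ Finset.univ.erase i, c j • f j := by
      rw [eq_neg_iff_add_eq_zero, Finset.add_sum_erase _ (fun j => c j • f j) (Finset.mem_univ i), hc]
    have h2 : c i • f i ∈ I := by
      rw [h1]
      refine I.neg_mem (I.sum_mem fun j hj => ?_)
      by_cases hcj : c j = 0
      · simp [hcj]
      · have hji : j < i := lt_of_le_of_ne (hmax j (by simpa using hcj)) (Finset.ne_of_mem_erase hj)
        exact Submodule.smul_of_tower_mem I _ (hprev j hji)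
    simpa [smul_smul, inv_mul_cancel₀ hci] using Submodule.smul_of_tower_mem I (c i)⁻¹ h2
  have hreg' := hreg.regular_mod_prev i (by simp)
  have h0 : (List.ofFn f)[(i : ℕ)]'(by simp) •
      (Submodule.Quotient.mk 1 : R ⧸ (I • ⊤ : Submodule R R)) = 0 := by
    rw [← Submodule.Quotient.mk_smul, Submodule.Quotient.mk_eq_zero]
    simpa using hfi
  have h1 := hreg'.right_eq_zero_of_smul h0
  rw [Submodule.Quotient.mk_eq_zero, Ideal.smul_eq_mul, Ideal.mul_top, ← Ideal.eq_top_iff_one] at h1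
  apply hreg.top_ne_smul
  rw [Ideal.smul_eq_mul, Ideal.mul_top, eq_comm, eq_top_iff, ← h1]
  exact Ideal.span_mono fun x hx => List.mem_of_mem_take hx

/-! ### The lowest degree of an ideal generated by forms -/

section span

variable {K : Type*} [Field K] {σ ι : Type*} 

/-- The elements of lowest degree of an ideal generated by forms of the same degree. -/
theorem mem_span_of_totalDegree_le [Fintype ι] {f : ι → MvPolynomial σ K} {d : ℕ}
    (hf : ∀ i, (f i).IsHomogeneous d) {p : MvPolynomial σ K}
    (hp : p ∈ Ideal.span (Set.range f)) (hpd : p.totalDegree ≤ d) :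
    p ∈ Submodule.span K (Set.range f) := by
  obtain ⟨c, rfl⟩ := Submodule.mem_span_range_iff_exists_fun _ |>.1 hp
  classical
  -- In degrees at most `d` only the constant terms of the multipliers contribute; above `d` both
  -- sides vanish.
  have key : ∑ i, c i • f i = ∑ i, (coeff 0 (c i)) • f i := by
    ext a
    by_cases had : a.degree ≤ d
    · rw [coeff_sum, coeff_sum]
      refine Finset.sum_congr rfl fun i _ => ?_
      rw [smul_eq_mul, coeff_mul, coeff_smul, smul_eq_mul]
      refine Finset.sum_eq_single (0, a) ?_ (by simp)
      rintro ⟨u, v⟩ huv hne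
      rw [Finset.HasAntidiagonal.mem_antidiagonal] at huv
      by_contra h0
      have hv := not_imp_comm.1 (hf i).coeff_eq_zero (right_ne_zero_of_mul h0)
      have hdeg := congrArg Finsupp.degree huv
      rw [map_add] at hdeg
      simp only at hdeg hv
      have hu : u = 0 := (Finsupp.degree_eq_zero_iff u).1 (by omega)
      subst hu
      rw [zero_add] at huv
      exact hne (Prod.ext rfl huv)
    · rw [coeff_eq_zero_of_totalDegree_lt, coeff_sum, Finset.sum_eq_zero]
      · intro i _
        rw [coeff_smul, (hf i).coeff_eq_zero (by omega), smul_zero]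
      · exact lt_of_le_of_lt hpd (not_le.1 had)
  rw [key]
  exact Submodule.sum_mem _ fun i _ => Submodule.smul_mem _ _ (Submodule.subset_span ⟨i, rfl⟩)

theorem isHomogeneous_of_mem_span {f : ι → MvPolynomial σ K} {d : ℕ}
    (hf : ∀ i, (f i).IsHomogeneous d) {p : MvPolynomial σ K}
    (hp : p ∈ Submodule.span K (Set.range f)) : p.IsHomogeneous d := by
  have : Submodule.span K (Set.range f) ≤ homogeneousSubmodule σ K d :=
    Submodule.span_le.2 (by rintro _ ⟨i, rfl⟩; exact hf i)
  exact this hp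

theorem mem_ideal_span_of_mem_span {f : ι → MvPolynomial σ K} {p : MvPolynomial σ K}
    (hp : p ∈ Submodule.span K (Set.range f)) : p ∈ Ideal.span (Set.range f) :=
  Submodule.span_le_restrictScalars K (MvPolynomial σ K) _ hp

end span

/-! ### Minors of powers of linear forms -/

section powers_of_linear_forms

variable {K R : Type*} [Field K] [CommRing R] [Algebra K R] {n : ℕ}

theorem coeff_sum_C_mul_X_pow (y : Fin n → R) {d : ℕ} {b : Fin n →₀ ℕ} (hb : b.degree = d) :
    coeff b ((∑ j, C (y j) * X j) ^ d) = (Nat.multinomial Finset.univ b : R) * ∏ j, y j ^ b j := by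
  have hterm : ∀ k : Fin n → ℕ, (Nat.multinomial Finset.univ k : MvPolynomial (Fin n) R) *
      ∏ j, (C (y j) * X j) ^ k j = monomial (Finsupp.equivFunOnFinite.symm k)
        ((Nat.multinomial Finset.univ k : R) * ∏ j, y j ^ k j) := by
    intro k
    rw [monomial_eq, Finsupp.prod_fintype _ _ (fun _ => pow_zero _)]
    simp [mul_pow, Finset.prod_mul_distrib, mul_assoc]
  rw [Finset.sum_pow_eq_sum_piAntidiag, coeff_sum, Finset.sum_eq_single (b : Fin n → ℕ)]
  · rw [hterm, coeff_monomial, if_pos (by ext; simp)]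
  · intro k _ hk
    rw [hterm, coeff_monomial, if_neg]
    rintro rfl
    exact hk (by ext; simp)
  · intro h
    refine absurd (Finset.mem_piAntidiag.2 ⟨?_, by simp⟩) h
    rw [← hb, Finsupp.degree_eq_sum]

theorem linSubst_eq_sum (N : Matrix (Fin n) (Fin n) R) (p : MvPolynomial (Fin n) K) :
    linSubst K N p = ∑ a ∈ p.support, C (algebraMap K R (coeff a p)) *
      ∏ k, (∑ j, C (N k j) * X j) ^ a k := by
  rw [linSubst, aeval_def, eval₂_eq']
  rfl

theorem genericMinor_X_pow (d : ℕ) (b : Fin n → Fin n →₀ ℕ) (hb : ∀ j, (b j).degree = d)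
    (hinj : Function.Injective b) [CharZero K] :
    genericMinor (fun i => (X i : MvPolynomial (Fin n) K) ^ d) b ≠ 0 := by
  have hentry : ∀ i j, genericCoeff ((X i : MvPolynomial (Fin n) K) ^ d) (b j) =
      (Nat.multinomial Finset.univ (b j) : MvPolynomial (Fin n × Fin n) K) *
        monomial ((b j).mapDomain fun k => (i, k)) 1 := by
    intro i j
    rw [genericCoeff, map_pow, linSubst, aeval_X, coeff_sum_C_mul_X_pow _ (hb j)]
    congr 1
    rw [monomial_eq, Finsupp.prod_mapDomain_index_inj (fun _ _ h => (Prod.ext_iff.1 h).2),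
      Finsupp.prod_fintype _ _ (fun _ => pow_zero _)]
    simp
  have hdet : genericMinor (fun i => (X i : MvPolynomial (Fin n) K) ^ d) b =
      (∏ j, (Nat.multinomial Finset.univ (b j) : MvPolynomial (Fin n × Fin n) K)) *
        (Matrix.of fun i j => monomial ((b j).mapDomain fun k => (i, k)) (1 : K)).det := by
    rw [genericMinor, ← Matrix.det_mul_row]
    congr 1
    ext1 i j
    simp [hentry]
  rw [hdet]
  refine mul_ne_zero (Finset.prod_ne_zero_iff.2 fun j _ =>
    Nat.cast_ne_zero.2 (Nat.multinomial_pos _ _).ne') ?_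
  -- `B τ` is the exponent of the Leibniz term of `τ`. Its row `τ i` is `b i`, so injectivity of `b`
  -- recovers `τ` and no terms cancel.
  let B : Equiv.Perm (Fin n) → (Fin n × Fin n →₀ ℕ) := fun τ =>
    ∑ i, (b i).mapDomain fun k => (τ i, k)
  have hB : ∀ τ i k, B τ (τ i, k) = b i k := by
    intro τ i k
    simp only [B, Finsupp.finsetSum_apply]
    rw [Finset.sum_eq_single i]
    · exact Finsupp.mapDomain_apply (fun _ _ h => (Prod.ext_iff.1 h).2) _ _
    · intro l _ hl
      apply Finsupp.mapDomain_of_notMem_range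
      rintro ⟨m, hm⟩
      exact hl (τ.injective (Prod.ext_iff.1 hm).1)
    · simp
  have hBinj : Function.Injective B := by
    intro τ ρ h
    have : ∀ i, τ⁻¹ i = ρ⁻¹ i := by
      intro i
      apply hinj
      ext k
      have h1 := hB τ (τ⁻¹ i) k
      have h2 := hB ρ (ρ⁻¹ i) k
      simp only [← Equiv.Perm.mul_apply, mul_inv_cancel, Equiv.Perm.one_apply] at h1 h2
      rw [← h1, ← h2, h]
    exact inv_injective (Equiv.ext this)
  intro h0
  have h1 := congrArg (coeff (B 1)) h0
  rw [Matrix.det_apply, coeff_sum, coeff_zero] at h1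
  have hprod : ∀ τ : Equiv.Perm (Fin n), ∏ i, (Matrix.of fun i j =>
      monomial ((b j).mapDomain fun k => (i, k)) (1 : K)) (τ i) i = monomial (B τ) 1 := by
    intro τ
    simp only [Matrix.of_apply, B]
    rw [monomial_sum_one]
  rw [Finset.sum_eq_single 1] at h1
  · rw [hprod] at h1
    simp at h1
  · intro τ _ hτ
    rw [hprod, Units.smul_def, coeff_smul, coeff_monomial, if_neg (fun h => hτ (hBinj h)), smul_zero]
  · simp

end powers_of_linear_forms

/-! ### Degeneration of triangular families -/

section triangular

variable {K : Type*} [Field K] {n : ℕ}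

theorem eq_zero_of_mem_supported_Ici {i : Fin n} {p : MvPolynomial (Fin n) K}
    (hp : p ∈ supported K (Set.Ici i)) {a : Fin n →₀ ℕ} (ha : a ∈ p.support) {k : Fin n}
    (hk : a k ≠ 0) : i ≤ k :=
  mem_supported.1 hp ((mem_vars_iff_mem_support k).2 ⟨a, ha, Finsupp.mem_support_iff.2 hk⟩)

/-- Every monomial of `p` other than `x_i ^ d` contains some `x_k` with `k > i`, which is sent to
zero. -/
theorem linSubst_eq_pow_of_rows_eq_zero {i : Fin n} {d : ℕ} {p : MvPolynomial (Fin n) K}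
    (hhom : p.IsHomogeneous d) (hp : p ∈ supported K (Set.Ici i)) (N : Matrix (Fin n) (Fin n) K)
    (hN : ∀ k, i < k → ∀ j, N k j = 0) :
    linSubst K N p = C (coeff (Finsupp.single i d) p) * linSubst K N (X i ^ d) := by
  rw [linSubst_eq_sum, Finset.sum_eq_single (Finsupp.single i d)]
  · simp only [Algebra.algebraMap_self, RingHom.id_apply]
    congr 1
    rw [map_pow, linSubst, aeval_X, Finset.prod_eq_single i]
    · simp
    · intro k _ hk
      simp [Finsupp.single_eq_of_ne hk]
    · simp
  · intro a ha hne
    obtain ⟨k, hki, hk⟩ : ∃ k, k ≠ i ∧ a k ≠ 0 := by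
      by_contra! h
      apply hne
      have ha' : a = Finsupp.single i (a i) := by
        ext k
        by_cases hk : k = i
        · subst hk; simp
        · rw [h k hk, Finsupp.single_eq_of_ne hk]
      have hdeg : a.degree = d := not_imp_comm.1 hhom.coeff_eq_zero (mem_support_iff.1 ha)
      rw [ha', Finsupp.degree_single] at hdeg
      rw [ha', hdeg]
    have hik := lt_of_le_of_ne (eq_zero_of_mem_supported_Ici hp ha hk) hki.symm
    rw [Finset.prod_eq_zero (Finset.mem_univ k), mul_zero]
    simp [hN k hik, hk]
  · intro h
    simp [notMem_support_iff.1 h]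

theorem linSubst_eq_smul_of_rows {i : Fin n} {d : ℕ} {p : MvPolynomial (Fin n) K}
    (hhom : p.IsHomogeneous d) (hp : p ∈ supported K (Set.Ici i)) (M N : Matrix (Fin n) (Fin n) K)
    (t : K) (hN : ∀ k, i ≤ k → ∀ j, M k j = t * N k j) :
    linSubst K M p = C (t ^ d) * linSubst K N p := by
  rw [linSubst_eq_sum, linSubst_eq_sum, Finset.mul_sum]
  refine Finset.sum_congr rfl fun a ha => ?_
  rw [mul_left_comm]
  congr 1
  have hdeg : a.degree = d := not_imp_comm.1 hhom.coeff_eq_zero (mem_support_iff.1 ha)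
  rw [← hdeg, Finsupp.degree_eq_sum, ← Finset.prod_pow_eq_pow_sum, map_prod,
    ← Finset.prod_mul_distrib]
  refine Finset.prod_congr rfl fun k _ => ?_
  by_cases hk : a k = 0
  · simp [hk]
  · have hik := eq_zero_of_mem_supported_Ici hp ha hk
    rw [map_pow, ← mul_pow, Finset.mul_sum]
    simp only [hN k hik, map_mul, mul_assoc]

/-- For a triangular family the minors at any `n` monomials are generically nonzero: the family
degenerates to the powers of the variables. -/
theorem genericMinor_ne_zero_of_triangular [CharZero K] {d : ℕ} (f : Fin n → MvPolynomial (Fin n) K)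
    (hhom : ∀ i, (f i).IsHomogeneous d) (hf : ∀ i, f i ∈ supported K (Set.Ici i))
    (hc : ∀ i, coeff (Finsupp.single i d) (f i) ≠ 0) (b : Fin n → Fin n →₀ ℕ)
    (hb : ∀ j, (b j).degree = d) (hinj : Function.Injective b) : genericMinor f b ≠ 0 := by
  obtain ⟨y, hy⟩ := exists_eval_ne_zero_GL (genericMinor_X_pow (K := K) d b hb hinj)
  rw [eval_genericMinor] at hy
  -- For `f i`, row `k` is scaled by `s ^ (k - i)`: the global scaling `s ^ k` with `s ^ i` factored
  -- out. Truncation for `k < i` is harmless, as those variables do not occur in `f i`. At `s = 0`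
  -- only `x_i` survives.
  let N : Fin n → Matrix (Fin n) (Fin n) (Polynomial K) := fun i =>
    Matrix.of fun k j => Polynomial.X ^ ((k : ℕ) - i) * Polynomial.C (y.1 k j)
  let N' : K → Fin n → Matrix (Fin n) (Fin n) K := fun s i =>
    Matrix.of fun k j => s ^ ((k : ℕ) - i) * y.1 k j
  let E : Polynomial K := (Matrix.of fun i j => coeff (b j) (linSubst K (N i) (f i))).det
  have hE : ∀ s, E.eval s = (Matrix.of fun i j => coeff (b j) (linSubst K (N' s i) (f i))).det := by
    intro s
    rw [← Polynomial.coe_evalRingHom, RingHom.map_det]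
    congr 1
    ext i j
    have hNN : (N i).map (Polynomial.aeval (R := K) s) = N' s i := by
      ext k l
      simp [N, N']
      exact mul_comm _ _
    have h := map_linSubst (K := K) (Polynomial.aeval (R := K) s) (N i) (f i)
    rw [hNN] at h
    rw [Matrix.of_apply, ← h, coeff_map]
    simp
  have hE0 : E.eval 0 ≠ 0 := by
    rw [hE]
    have hrow : (Matrix.of fun i j => coeff (b j) (linSubst K (N' 0 i) (f i))) =
        Matrix.of fun i j => coeff (Finsupp.single i d) (f i) *
          (Matrix.of fun i j => coeff (b j) (linSubst K y.1 (X i ^ d))) i j := by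
      ext i j
      rw [Matrix.of_apply, linSubst_eq_pow_of_rows_eq_zero (hhom i) (hf i), coeff_C_mul]
      · simp [linSubst, N']
      · intro k hk l
        have : (k : ℕ) - i ≠ 0 := by
          have := Fin.lt_def.1 hk
          omega
        simp [N', this]
    rw [hrow, Matrix.det_mul_column]
    exact mul_ne_zero (Finset.prod_ne_zero_iff.2 fun i _ => hc i) hy
  have hE' : E ≠ 0 := fun h => hE0 (by simp [h])
  -- The factor `X` ensures `s ≠ 0`, so the factors `(s ^ i) ^ d` pulled out of the rows are
  -- nonzero.
  obtain ⟨s, hs⟩ : ∃ s, (E * Polynomial.X).eval s ≠ 0 := by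
    by_contra! h
    exact mul_ne_zero hE' Polynomial.X_ne_zero (Polynomial.funext fun s => by simpa using h s)
  rw [Polynomial.eval_mul, Polynomial.eval_X] at hs
  intro h0
  have h1 := eval_genericMinor f b (Matrix.of fun k j => s ^ (k : ℕ) * y.1 k j)
  have hrow : (Matrix.of fun i j => coeff (b j)
      (linSubst K (Matrix.of fun k j => s ^ (k : ℕ) * y.1 k j) (f i))) =
      Matrix.of fun (i : Fin n) j => (s ^ (i : ℕ)) ^ d *
        (Matrix.of fun i j => coeff (b j) (linSubst K (N' s i) (f i))) i j := by
    ext i j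
    rw [Matrix.of_apply, linSubst_eq_smul_of_rows (hhom i) (hf i) _ (N' s i) (s ^ (i : ℕ)),
      coeff_C_mul]
    · rfl
    · intro k hk l
      have : (k : ℕ) = i + (k - i) := by
        have := Fin.le_def.1 hk
        omega
      simp only [N', Matrix.of_apply]
      rw [← mul_assoc, ← pow_add, ← this]
  rw [hrow, Matrix.det_mul_column, ← hE, h0, map_zero] at h1
  exact mul_ne_zero (Finset.prod_ne_zero_iff.2 fun (i : Fin n) _ =>
    pow_ne_zero _ (pow_ne_zero _ (right_ne_zero_of_mul hs))) (left_ne_zero_of_mul hs) h1.symm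

end triangular

/-! ### The degree `d` part of the generic initial ideal -/

section degree_d_part

variable {K : Type*} [Field K] {n : ℕ}

theorem finite_monomialsOfDegree (J : Ideal (MvPolynomial (Fin n) K)) (d : ℕ) :
    (monomialsOfDegree J d).Finite :=
  (finite_degree_le d).subset fun _ h => h.1.le

theorem mem_monomialsOfDegree_initialIdeal {I : Ideal (MvPolynomial (Fin n) K)} {d : ℕ}
    {g : GL (Fin n) K} {a : Fin n →₀ ℕ} :
    a ∈ monomialsOfDegree (initialIdeal (revlex n) (I.map (coordChange g))) d ↔
      a.degree = d ∧ ∃ p ∈ I, p ≠ 0 ∧ (revlex n).degree (coordChange g p) = a := by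
  rw [monomialsOfDegree, Set.mem_ofPred_eq, monomial_mem_initialIdeal_iff,
    mem_leadingExponents_map_iff]

/-- Both inequalities compare with the `n`-dimensional span of the `f i`: elements with distinct
leading monomials are independent, and the coefficients at these monomials determine an element,
since a nonzero one has its leading coefficient there. -/
theorem ncard_monomialsOfDegree_initialIdeal {d : ℕ} {f : Fin n → MvPolynomial (Fin n) K}
    (hhom : ∀ i, (f i).IsHomogeneous d) (hli : LinearIndependent K f) (g : GL (Fin n) K) :
    (monomialsOfDegree (initialIdeal (revlex n)
      ((Ideal.span (Set.range f)).map (coordChange g))) d).ncard = n := by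
  classical
  set M := monomialsOfDegree (initialIdeal (revlex n)
      ((Ideal.span (Set.range f)).map (coordChange g))) d with hM
  have hfin : M.Finite := finite_monomialsOfDegree _ _
  have : Fintype M := hfin.fintype
  rw [← Nat.card_coe_set_eq, Nat.card_eq_fintype_card]
  have hspan : Module.finrank K (Submodule.span K (Set.range f)) = n := by
    rw [finrank_span_eq_card hli, Fintype.card_fin]
  have : FiniteDimensional K (Submodule.span K (Set.range f)) :=
    FiniteDimensional.span_of_finite K (Set.finite_range f)
  choose p hpI hp0 hpdeg using fun a : M => (mem_monomialsOfDegree_initialIdeal.1 a.2).2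
  have hpspan : ∀ a, p a ∈ Submodule.span K (Set.range f) := fun a => by
    refine mem_span_of_totalDegree_le hhom (hpI a) ?_
    rw [← totalDegree_coordChange g, totalDegree_eq_degree_revlex, hpdeg]
    exact a.2.1.le
  apply le_antisymm
  · have hpli : LinearIndependent K fun a => (⟨p a, hpspan a⟩ : Submodule.span K (Set.range f)) := by
      rw [Fintype.linearIndependent_iff]
      intro c hc
      have hdet := det_coeff_degree_ne_zero (revlex n) (fun a => coordChange g (p a))
        (fun a => (map_ne_zero_iff _ (coordChange_injective g)).2 (hp0 a)) _ hpdeg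
        Subtype.val_injective
      by_contra! hne
      refine hdet (Matrix.exists_vecMul_eq_zero_iff.1 ⟨c, Function.ne_iff.2 hne, ?_⟩)
      have hc' : ∑ a, c a • coordChange g (p a) = 0 := by
        have := congrArg (fun x : Submodule.span K (Set.range f) => coordChange g x.1) hc
        simpa using this
      ext b
      have := congrArg (coeff b.1) hc'
      simpa [Matrix.vecMul, dotProduct, coeff_sum] using this
    exact hpli.fintype_card_le_finrank.trans hspan.le
  · let φ : Submodule.span K (Set.range f) →ₗ[K] (M → K) :=
      LinearMap.pi fun a => (lcoeff K a.1).comp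
        ((coordChange g).toLinearMap.comp (Submodule.subtype _))
    have hφ : Function.Injective φ := by
      rw [injective_iff_map_eq_zero]
      intro x hx
      by_contra hx0
      have hx1 : (x : MvPolynomial (Fin n) K) ≠ 0 := by simpa using hx0
      have hgx : coordChange g x.1 ≠ 0 := (map_ne_zero_iff _ (coordChange_injective g)).2 hx1
      have hdeg : ((revlex n).degree (coordChange g x.1)).degree = d := by
        rw [← totalDegree_eq_degree_revlex, totalDegree_coordChange]
        exact (isHomogeneous_of_mem_span hhom x.2).totalDegree hx1
      have hmem : (revlex n).degree (coordChange g x.1) ∈ M :=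
        mem_monomialsOfDegree_initialIdeal.2 ⟨hdeg, x, mem_ideal_span_of_mem_span x.2, hx1, rfl⟩
      exact (revlex n).coeff_degree_ne_zero_iff.2 hgx (congrFun hx ⟨_, hmem⟩)
    have := LinearMap.finrank_le_finrank_of_injective hφ
    rwa [hspan, Module.finrank_fintype_fun_eq_card] at this

theorem isRevlexSet_of_triangular [CharZero K] {d : ℕ} {f : Fin n → MvPolynomial (Fin n) K}
    (hhom : ∀ i, (f i).IsHomogeneous d) (hf : ∀ i, f i ∈ supported K (Set.Ici i))
    (hc : ∀ i, coeff (Finsupp.single i d) (f i) ≠ 0) {J : Ideal (MvPolynomial (Fin n) K)}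
    (hJ : IsGenericInitialIdeal (revlex n) (Ideal.span (Set.range f)) J)
    (hcard : (monomialsOfDegree J d).ncard = n) : IsRevlexSet (monomialsOfDegree J d) := by
  intro a ha c hca hlt
  by_contra hcM
  have hcd : c.degree = d := hca.trans ha.1
  -- Exchange `a` for the larger `c`: still `n` monomials, so their generic minor is nonzero.
  set T := insert c (monomialsOfDegree J d \ {a}) with hT
  have hMfin := finite_monomialsOfDegree J d
  have hTfin : T.Finite := (hMfin.subset Set.sdiff_subset).insert c
  have hTcard : T.ncard = n := by
    rw [hT, Set.ncard_insert_of_notMem (fun h => hcM h.1) (hMfin.subset Set.sdiff_subset),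
      Set.ncard_sdiff_singleton_add_one ha hMfin, hcard]
  have : Finite T := hTfin
  let eT : Fin n ≃ T := (Finite.equivFinOfCardEq hTcard).symm
  obtain ⟨i₀, hi₀⟩ := eT.surjective ⟨c, Set.mem_insert _ _⟩
  have hTd : ∀ x ∈ T, x.degree = d := by
    rintro x (rfl | hx)
    · exact hcd
    · exact hx.1.1
  have hminor := genericMinor_ne_zero_of_triangular f hhom hf hc (fun i => (eT i).1)
    (fun i => hTd _ (eT i).2) (Subtype.val_injective.comp eT.injective)
  obtain ⟨p, hp0, hp⟩ := hJ.exists_polynomial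
  obtain ⟨g, hg⟩ := exists_eval_ne_zero_GL (mul_ne_zero hp0 hminor)
  rw [map_mul, eval_genericMinor] at hg
  have hJg := hp g (left_ne_zero_of_mul hg)
  have hmem : ∀ x, monomial x (1 : K) ∈ J ↔ x ∈ leadingExponents (revlex n)
      ((Ideal.span (Set.range f)).map (coordChange g)) := fun x => by
    rw [← hJg, monomial_mem_initialIdeal_iff]
  refine hcM ⟨hcd, (hmem c).2 ?_⟩
  have hkey := mem_leadingExponents_of_minor_ne_zero (e := d)
    (I := (Ideal.span (Set.range f)).map (coordChange g)) (fun i => coordChange g (f i))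
    (fun i => Ideal.mem_map_of_mem _ (Ideal.subset_span ⟨i, rfl⟩))
    (fun i => by
      rw [totalDegree_coordChange]
      exact (hhom i).totalDegree_le) _ (right_ne_zero_of_mul hg) i₀ ?_
  · rwa [hi₀] at hkey
  · rw [hi₀]
    intro x hx hxd hcx
    -- A leading exponent `x > c` of degree at most `d` has degree exactly `d`, and differs from `a`
    -- because `a < c`; hence it survives in `T`.
    have hxd' : x.degree = d := le_antisymm hxd (hcd ▸ revlex_degree_le hcx.le)
    have hxT : x ∈ T := by
      refine Or.inr ⟨⟨hxd', (hmem x).2 hx⟩, ?_⟩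
      rintro rfl
      exact lt_asymm hlt hcx
    obtain ⟨j, hj⟩ := eT.surjective ⟨x, hxT⟩
    exact ⟨j, by rw [hj]⟩

end degree_d_part

/-! ### Pure powers forced by regularity -/

section regular_sequence

variable {K : Type*} [Field K] {n d : ℕ}

theorem exists_ne_of_degree_eq {σ : Type*} {i : σ} {a : σ →₀ ℕ} (ha : a.degree = d)
    (hne : a ≠ Finsupp.single i d) : ∃ k, k ≠ i ∧ a k ≠ 0 := by
  by_contra! h
  have ha' : a = Finsupp.single i (a i) := by
    ext k
    by_cases hk : k = i
    · subst hk; simp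
    · rw [h k hk, Finsupp.single_eq_of_ne hk]
  rw [ha', Finsupp.degree_single] at ha
  rw [ha', ha] at hne
  exact hne rfl

theorem degree_ne_zero_of_isRegular {f : Fin n → MvPolynomial (Fin n) K}
    (hhom : ∀ i, (f i).IsHomogeneous d)
    (hreg : RingTheory.Sequence.IsRegular (MvPolynomial (Fin n) K) (List.ofFn f)) (i : Fin n) :
    d ≠ 0 := by
  rintro rfl
  have hfi : f i = C (coeff 0 (f i)) :=
    totalDegree_eq_zero_iff_eq_C.1 (Nat.le_zero.1 (hhom i).totalDegree_le)
  have h0 := (linearIndependent_of_isRegular (K := K) f hreg).ne_zero i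
  have hunit : IsUnit (f i) := by
    rw [hfi] at h0 ⊢
    exact (isUnit_iff_ne_zero.2 fun h => h0 (by rw [h, C_0])).map C
  apply hreg.top_ne_smul
  rw [Ideal.smul_eq_mul, Ideal.mul_top]
  exact (Ideal.eq_top_of_isUnit_mem _ (Ideal.subset_span (by simp)) hunit).symm

theorem span_ne_top_of_constantCoeff {s : Set (MvPolynomial (Fin n) K)}
    (hs : ∀ p ∈ s, constantCoeff p = 0) : Ideal.span s ≠ ⊤ := by
  intro h
  have hle : Ideal.span s ≤ RingHom.ker (constantCoeff (R := K) (σ := Fin n)) := Ideal.span_le.2 hs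
  rw [h] at hle
  exact RingHom.ker_ne_top _ (top_le_iff.1 hle)

/-- Otherwise all forms lie in the ideal generated by the `f j` with `j < i` and the `x_k` with `k >
i`: a proper ideal with at most `n - 1` generators. -/
theorem coeff_single_ne_zero_of_triangular {f : Fin n → MvPolynomial (Fin n) K}
    (hhom : ∀ i, (f i).IsHomogeneous d)
    (hreg : RingTheory.Sequence.IsRegular (MvPolynomial (Fin n) K) (List.ofFn f))
    (hf : ∀ i, f i ∈ supported K (Set.Ici i)) (i : Fin n) :
    coeff (Finsupp.single i d) (f i) ≠ 0 := by
  intro h0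
  have hd := degree_ne_zero_of_isRegular hhom hreg i
  set s : Set (MvPolynomial (Fin n) K) := f '' Set.Iio i ∪ X '' Set.Ioi i with hs
  have hfin : s.Finite := ((Set.toFinite _).image _).union ((Set.toFinite _).image _)
  refine not_subset_span_of_isWeaklyRegular hreg.toIsWeaklyRegular hfin ?_ ?_ ?_
  · have h1 : (f '' Set.Iio i).ncard ≤ i := by
      refine (Set.ncard_image_le (Set.toFinite _)).trans ?_
      rw [Set.ncard_eq_toFinset_card']
      simp
    have h2 : ((X : Fin n → MvPolynomial (Fin n) K) '' Set.Ioi i).ncard ≤ n - 1 - i := by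
      refine (Set.ncard_image_le (Set.toFinite _)).trans ?_
      rw [Set.ncard_eq_toFinset_card']
      simp
    have h3 := Set.ncard_union_le (f '' Set.Iio i) (X '' Set.Ioi i)
    rw [← hs] at h3
    rw [List.length_ofFn]
    have := i.2
    omega
  · apply span_ne_top_of_constantCoeff
    rintro _ (⟨j, -, rfl⟩ | ⟨j, -, rfl⟩)
    · exact (hhom j).coeff_eq_zero (by simpa using hd.symm)
    · simp
  · intro r hr
    obtain ⟨j, rfl⟩ := (List.mem_ofFn' _ _).1 hr
    by_cases hji : j < i
    · exact Ideal.subset_span (Or.inl ⟨j, hji, rfl⟩)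
    · refine Ideal.span_mono Set.subset_union_right (mem_ideal_span_X_image.2 fun a ha => ?_)
      have hdeg : a.degree = d := not_imp_comm.1 (hhom j).coeff_eq_zero (mem_support_iff.1 ha)
      have hne : a ≠ Finsupp.single i d := by
        rintro rfl
        rcases (not_lt.1 hji).lt_or_eq with hij | rfl
        · exact hij.not_ge (eq_zero_of_mem_supported_Ici (hf j) ha (by simpa using hd))
        · exact mem_support_iff.1 ha h0
      obtain ⟨k, hki, hk⟩ := exists_ne_of_degree_eq hdeg hne
      have hjk := eq_zero_of_mem_supported_Ici (hf j) ha hk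
      exact ⟨k, lt_of_le_of_ne ((not_lt.1 hji).trans hjk) hki.symm, hk⟩

/-- If no `f j` involved `x_i ^ d`, all would lie in the ideal of the other `n - 1` variables. A
monomial ideal contains every monomial of its members. -/
theorem X_pow_mem_of_isMonomialIdeal {f : Fin n → MvPolynomial (Fin n) K}
    (hhom : ∀ i, (f i).IsHomogeneous d)
    (hreg : RingTheory.Sequence.IsRegular (MvPolynomial (Fin n) K) (List.ofFn f))
    (hI : IsMonomialIdeal (Ideal.span (Set.range f))) (i : Fin n) :
    X i ^ d ∈ Ideal.span (Set.range f) := by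
  obtain ⟨j, hj⟩ : ∃ j, coeff (Finsupp.single i d) (f j) ≠ 0 := by
    by_contra! h
    refine not_subset_span_of_isWeaklyRegular hreg.toIsWeaklyRegular
      (s := X '' ({i}ᶜ : Set (Fin n))) ((Set.toFinite _).image _) ?_ ?_ ?_
    · refine (Set.ncard_image_le (Set.toFinite _)).trans_lt ?_
      rw [Set.ncard_compl, Set.ncard_singleton, Nat.card_fin, List.length_ofFn]
      have := i.2
      omega
    · apply span_ne_top_of_constantCoeff
      rintro _ ⟨k, -, rfl⟩
      simp
    · intro r hr
      obtain ⟨j, rfl⟩ := (List.mem_ofFn' _ _).1 hr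
      refine mem_ideal_span_X_image.2 fun a ha => ?_
      have hdeg : a.degree = d := not_imp_comm.1 (hhom j).coeff_eq_zero (mem_support_iff.1 ha)
      refine exists_ne_of_degree_eq hdeg ?_
      rintro rfl
      exact mem_support_iff.1 ha (h j)
  obtain ⟨A, hA⟩ := hI
  have hfj : f j ∈ Ideal.span (Set.range f) := Ideal.subset_span ⟨j, rfl⟩
  rw [hA, mem_ideal_span_monomial_image] at hfj
  rw [hA, X_pow_eq_monomial, mem_ideal_span_monomial_image]
  intro a ha
  classical
  rw [support_monomial, if_neg one_ne_zero, Finset.mem_singleton] at ha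
  exact hfj a (by rw [ha]; exact mem_support_iff.2 hj)

/-- The span of the `x_i ^ d` lies in that of the `f i`, and both have dimension `n`. -/
theorem span_eq_span_X_pow_of_isMonomialIdeal {f : Fin n → MvPolynomial (Fin n) K}
    (hhom : ∀ i, (f i).IsHomogeneous d)
    (hreg : RingTheory.Sequence.IsRegular (MvPolynomial (Fin n) K) (List.ofFn f))
    (hI : IsMonomialIdeal (Ideal.span (Set.range f))) :
    Ideal.span (Set.range f) =
      Ideal.span (Set.range fun i => (X i : MvPolynomial (Fin n) K) ^ d) := by
  have hXI := X_pow_mem_of_isMonomialIdeal hhom hreg hI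
  have hX : LinearIndependent K fun i => (X i : MvPolynomial (Fin n) K) ^ d := by
    have h := (basisMonomials (Fin n) K).linearIndependent.comp
      (fun i : Fin n => Finsupp.single i d) fun i j hij =>
        (Finsupp.single_left_inj (degree_ne_zero_of_isRegular hhom hreg i)).1 hij
    simpa [Function.comp_def, X_pow_eq_monomial] using h
  have hle : Submodule.span K (Set.range fun i => (X i : MvPolynomial (Fin n) K) ^ d) ≤
      Submodule.span K (Set.range f) := by
    refine Submodule.span_le.2 ?_
    rintro _ ⟨i, rfl⟩
    exact mem_span_of_totalDegree_le hhom (hXI i) (totalDegree_X_pow i d).le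
  have : FiniteDimensional K (Submodule.span K (Set.range f)) :=
    FiniteDimensional.span_of_finite K (Set.finite_range f)
  have heq := Submodule.eq_of_le_of_finrank_eq hle (by
    rw [finrank_span_eq_card hX, finrank_span_eq_card (linearIndependent_of_isRegular f hreg)])
  apply le_antisymm
  · refine Ideal.span_le.2 ?_
    rintro _ ⟨i, rfl⟩
    apply mem_ideal_span_of_mem_span
    rw [heq]
    exact Submodule.subset_span ⟨i, rfl⟩
  · refine Ideal.span_le.2 ?_
    rintro _ ⟨i, rfl⟩
    exact hXI i

end regular_sequence

/-! ### The main theorem -/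

theorem theorem1p5 {K : Type*} [Field K] [IsAlgClosed K] [CharZero K] (n d : ℕ)
    (f : Fin n → MvPolynomial (Fin n) K)
    (hhom : ∀ i, (f i).IsHomogeneous d)
    (hreg : RingTheory.Sequence.IsRegular (MvPolynomial (Fin n) K) (List.ofFn f)) :
    (∃! J, IsGenericInitialIdeal (revlex n) (Ideal.span (Set.range f)) J) ∧
    ∀ J, IsGenericInitialIdeal (revlex n) (Ideal.span (Set.range f)) J →
      (monomialsOfDegree J d).ncard = n ∧
      ((∀ i, f i ∈ supported K (Set.Ici i)) → IsRevlexSet (monomialsOfDegree J d)) ∧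
      (IsMonomialIdeal (Ideal.span (Set.range f)) → IsRevlexSet (monomialsOfDegree J d)) := by
  obtain ⟨J₀, hJ₀⟩ := exists_isGenericInitialIdeal (Ideal.span (Set.range f))
  refine ⟨⟨J₀, hJ₀, fun J hJ => hJ.unique hJ₀⟩, fun J hJ => ?_⟩
  have hcard : (monomialsOfDegree J d).ncard = n := by
    obtain ⟨U, -, ⟨g, hg⟩, hU⟩ := hJ
    rw [← hU g hg]
    exact ncard_monomialsOfDegree_initialIdeal hhom (linearIndependent_of_isRegular f hreg) g
  refine ⟨hcard, fun hf => ?_, fun hI => ?_⟩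
  · exact isRevlexSet_of_triangular hhom hf (coeff_single_ne_zero_of_triangular hhom hreg hf) hJ
      hcard
  -- `J` depends only on the ideal, so the generators may be replaced by the triangular family `x_i
  -- ^ d`.
  · rw [span_eq_span_X_pow_of_isMonomialIdeal hhom hreg hI] at hJ
    refine isRevlexSet_of_triangular (fun i => isHomogeneous_X_pow i d) (fun i => ?_) (fun i => ?_)
      hJ hcard
    · exact pow_mem (X_mem_supported.2 Set.self_mem_Ici) d
    · rw [coeff_X_pow, if_pos rfl]
      exact one_ne_zero
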